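/- Call a relation $R\subseteq 2^\omega\times 2^\omega\times\omega^3$ semirecursive if there is a recursively enumerable set $W$ of tuples $(\sigma,\tau,l,m,n)\in 2^{<\omega}\times 2^{<\omega}\times\omega^3$ such that $R(x,y,l,m,n)$ holds if and only if $(\sigma,\tau,l,m,n)\in W$ for some initial segments $\sigma$ of $x$ and $\tau$ of $y$, and recursive if both $R$ and its complement are semirecursive. A binary relation $E$ on $2^\omega$ is (lightface) $\Pi^0_3$ if there is a recursive $R$ such that for all $x,y\in 2^\omega$ $$x\mathrel{E}y\iff\forall l\,\exists m\,\forall n\;R(x,y,l,m,n).$$ For $x,y\in 2^\omega$, write $x\le_m y$ if there is a total computable function $f:\omega\to\omega$ such that, for all $n$, $x(n)=1$ if and only if $y(f(n))=1$, and write $x\le_1 y$ if such an $f$ can be chosen injective. Let $x\equiv_m y$ mean $x\le_m y$ and $y\le_m x$, let $x\equiv_1 y$ mean $x\le_1 y$ and $y\le_1 x$, and let $\equiv_T$ be Turing equivalence. **Theorem.** Neither $\equiv_m$ nor $\equiv_1$ is $\Pi^0_3$. Moreover, no binary relation $E$ on $2^\omega$ with ${\equiv_1}\subseteq E\subseteq{\equiv_T}$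 is $\Pi^0_3$. -/

import Mathlib

/-- Reals: points of Cantor space `2^ω`. -/
abbrev Cantor : Type := ℕ → Bool

namespace Cantor

/-- The finite binary string `σ` is an initial segment of the real `x`. -/
def IsInitSeg (σ : List Bool) (x : Cantor) : Prop :=
  ∀ (i : ℕ) (h : i < σ.length), σ[i] = x i

/-- The set of natural numbers of which the real `x` is the characteristic function. -/
def toPred (x : Cantor) : ℕ → Prop := fun n => x n = true

/-- The real `x` as a (total) function on the natural numbers with values `0` and `1`. -/
def toPFun (x : Cantor) : ℕ →. ℕ := ((fun n => (x n).toNat : ℕ → ℕ) : ℕ →. ℕ)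

/-- Many-one equivalence of reals: many-one reducibility in both directions. -/
def MEquiv (x y : Cantor) : Prop := ManyOneEquiv x.toPred y.toPred

/-- One-one equivalence of reals: one-one reducibility in both directions. -/
def OneEquiv (x y : Cantor) : Prop := OneOneEquiv x.toPred y.toPred

/-- Turing equivalence of reals. -/
def TEquiv (x y : Cantor) : Prop := TuringEquivalent x.toPFun y.toPFun

/-- A relation on `2^ω × 2^ω × ω³` is lightface `Σ⁰₁` (semirecursive) if it is the union of the
basic open sets given by a recursively enumerable set of codes `(σ, τ, l, m, n)`. Such a code
stands for the set of all `(x, y, l, m, n)` with `σ ≺ x` and `τ ≺ y`. -/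
def IsSemirecursive (R : Cantor → Cantor → ℕ → ℕ → ℕ → Prop) : Prop :=
  ∃ W : List Bool × List Bool × ℕ × ℕ × ℕ → Prop, REPred W ∧
    ∀ x y l m n, R x y l m n ↔
      ∃ σ τ : List Bool, IsInitSeg σ x ∧ IsInitSeg τ y ∧ W (σ, τ, l, m, n)

/-- A relation on `2^ω × 2^ω × ω³` is recursive if both it and its complement are
semirecursive. -/
def IsRecursive (R : Cantor → Cantor → ℕ → ℕ → ℕ → Prop) : Prop :=
  IsSemirecursive R ∧ IsSemirecursive (fun x y l m n => ¬ R x y l m n)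

/-- A binary relation on `2^ω` is lightface `Π⁰₃` if it is defined by a formula
`∀ l ∃ m ∀ n R(x, y, l, m, n)` with `R` recursive. -/
def IsLightfacePi03 (E : Cantor → Cantor → Prop) : Prop :=
  ∃ R : Cantor → Cantor → ℕ → ℕ → ℕ → Prop, IsRecursive R ∧
    ∀ x y, E x y ↔ ∀ l, ∃ m, ∀ n, R x y l m n

end Cantor

/-! Fix a computable `x` taking both values infinitely often. All computable reals of this kind are
one-one equivalent to `x`, so they lie in the section `E x`, while `E x` lies in the countable
Turing degree of `x`. If `E` were `Π⁰₃`, the section would be `⋂ l, ⋃ m, F l m` with effectively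
closed `F l m`. By `exists_subset_of_forall_computable` each `⋃ m, F l m` has dense interior:
otherwise, inside some basic open set, a computable bi-infinite real could be built that leaves
every `F l m`. So the section is comeager, and by Baire it cannot be countable. -/

/-- Selection theorem: a total recursively enumerable relation has a computable selector. -/
theorem REPred.exists_computable_selector {α β : Type*} [Primcodable α] [Primcodable β]
    {P : α × β → Prop} (hP : REPred P) (htot : ∀ a, ∃ b, P (a, b)) :
    ∃ f : α → β, Computable f ∧ ∀ a, P (a, f a) := by
  obtain ⟨c, hc⟩ := Nat.Partrec.Code.exists_code.1 hP
  have hdom : ∀ p : α × β, P p ↔ ∃ x, x ∈ c.eval (Encodable.encode p) := by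
    intro p
    rw [hc]
    simp [Part.assert]
  -- Dovetailing: the stage codes a time bound together with a candidate `b`.
  let g : α → ℕ → Option β := fun a k =>
    (Encodable.decode (α := β) k.unpair.2).bind fun b =>
      (Nat.Partrec.Code.evaln k.unpair.1 c (Encodable.encode (a, b))).map fun _ => b
  have hg : Computable₂ g := by
    have h1 : Computable fun p : α × ℕ => Encodable.decode (α := β) p.2.unpair.2 :=
      Computable.decode.comp (Computable.snd.comp (Computable.unpair.comp Computable.snd))
    have h2 : Computable fun p : (α × ℕ) × β =>
        ((p.1.2.unpair.1, c), Encodable.encode (p.1.1, p.2)) :=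
      ((Computable.fst.comp (Computable.unpair.comp
        (Computable.snd.comp Computable.fst))).pair (Computable.const c)).pair
          (Computable.encode.comp ((Computable.fst.comp Computable.fst).pair Computable.snd))
    have h3 := Nat.Partrec.Code.primrec_evaln.to_comp.comp h2
    have h4 := Computable.option_map h3
      (g := fun p _ => p.2) (Computable.snd.comp Computable.fst).to₂
    exact Computable.option_bind h1 h4.to₂
  have hspec : ∀ a k b, b ∈ g a k → P (a, b) := by
    intro a k b hb
    simp only [g, Option.mem_def, Option.bind_eq_some_iff, Option.map_eq_some_iff] at hb
    obtain ⟨b', -, x, hx, rfl⟩ := hb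
    exact (hdom _).2 ⟨x, Nat.Partrec.Code.evaln_sound hx⟩
  have hex : ∀ a, (Nat.rfindOpt (g a)).Dom := by
    intro a
    obtain ⟨b, hb⟩ := htot a
    obtain ⟨x, hx⟩ := (hdom _).1 hb
    obtain ⟨k, hk⟩ := Nat.Partrec.Code.evaln_complete.1 hx
    refine Nat.rfindOpt_dom.2 ⟨Nat.pair k (Encodable.encode b), b, ?_⟩
    simp only [g, Nat.unpair_pair, Encodable.encodek, Option.bind_some, Option.mem_def,
      Option.map_eq_some_iff]
    exact ⟨x, hk, trivial⟩
  refine ⟨fun a => (Nat.rfindOpt (g a)).get (hex a),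
    (Partrec.rfindOpt hg).of_eq_tot fun a => Part.get_mem _, fun a => ?_⟩
  obtain ⟨k, hk⟩ := Nat.rfindOpt_spec (Part.get_mem (hex a))
  exact hspec a k _ hk

theorem REPred.comp {α β : Type*} [Primcodable α] [Primcodable β] {P : β → Prop} (hP : REPred P)
    {f : α → β} (hf : Computable f) : REPred fun a => P (f a) :=
  Partrec.comp hP hf

namespace Cantor

/-! ### Reducibilities between computable reals -/

/-- The real takes each of the two values infinitely often. -/
def IsBiInfinite (x : Cantor) : Prop := ∀ (b : Bool) (N : ℕ), ∃ k, N ≤ k ∧ x k = b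

theorem oneOneReducible_of_computable {x y : Cantor} (hx : Computable x) (hy : Computable y)
    (hinf : y.IsBiInfinite) : OneOneReducible x.toPred y.toPred := by
  have hex : ∀ a : ℕ × Bool, ∃ k, a.1 ≤ k ∧ y k = a.2 := fun a => hinf a.2 a.1
  let g : ℕ × Bool → ℕ := fun a => Nat.find (hex a)
  have hg : Computable g := by
    refine Computable.find (P := fun (a : ℕ × Bool) k => a.1 ≤ k ∧ y k = a.2) ?_ hex
    refine Computable.computablePred
      (((Primrec.and.to_comp.comp
        (Primrec.nat_le.decide.to_comp.comp (Computable.fst.comp Computable.fst) Computable.snd)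
        (Primrec.eq.decide.to_comp.comp (hy.comp Computable.snd)
          (Computable.snd.comp Computable.fst)))).of_eq fun p => ?_)
    simp
  have hg1 : ∀ a, a.1 ≤ g a := fun a => (Nat.find_spec (hex a)).1
  have hg2 : ∀ a, y (g a) = a.2 := fun a => (Nat.find_spec (hex a)).2
  -- `e n` exceeds the image of every number below `n`; searching from there makes the reduction
  -- strictly increasing, hence injective.
  let e : ℕ → ℕ := fun n => Nat.rec 0 (fun k r => g (r, x k) + 1) n
  have he : Computable e := by
    refine Computable.nat_rec (f := fun n : ℕ => n) (g := fun _ => 0)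
      (h := fun _ q => g (q.2, x q.1) + 1) Computable.id (Computable.const 0) ?_
    exact Computable.succ.comp (hg.comp ((Computable.snd.comp Computable.snd).pair
      (hx.comp (Computable.fst.comp Computable.snd))))
  have hf : StrictMono fun n => g (e n, x n) := by
    refine strictMono_nat_of_lt_succ fun n => ?_
    exact hg1 (e (n + 1), x (n + 1))
  refine ⟨fun n => g (e n, x n), hg.comp (he.pair hx), hf.injective, fun n => ?_⟩
  simp [toPred, hg2]

theorem oneEquiv_of_computable {x y : Cantor} (hx : Computable x) (hy : Computable y)
    (hxi : x.IsBiInfinite) (hyi : y.IsBiInfinite) : OneEquiv x y :=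
  ⟨oneOneReducible_of_computable hx hy hyi, oneOneReducible_of_computable hy hx hxi⟩

theorem OneEquiv.mEquiv {x y : Cantor} (h : OneEquiv x y) : MEquiv x y :=
  OneOneEquiv.to_many_one h

theorem turingReducible_of_manyOneReducible {x y : Cantor}
    (h : ManyOneReducible x.toPred y.toPred) : TuringReducible x.toPFun y.toPFun := by
  obtain ⟨f, hf, hxy⟩ := h
  have hfy : ∀ n, x n = y (f n) := fun n => Bool.eq_iff_iff.2 (hxy n)
  refine RecursiveIn.iff_nat.2 (Nat.RecursiveIn.of_eq (Nat.RecursiveIn.comp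
    (Nat.RecursiveIn.oracle y.toPFun rfl) (RecursiveIn.iff_nat.1 hf.partrec.recursiveIn))
    fun n => ?_)
  simp only [toPFun, hfy, PFun.coe_val]
  exact Part.bind_some _ _

theorem MEquiv.tEquiv {x y : Cantor} (h : MEquiv x y) : TEquiv x y :=
  ⟨turingReducible_of_manyOneReducible h.1, turingReducible_of_manyOneReducible h.2⟩

theorem countable_setOf_tEquiv {x : Cantor} (hx : Computable x) : {y | TEquiv x y}.Countable := by
  have hcomp : ∀ y, TEquiv x y → Computable fun n => (y n).toNat := by
    intro y hy
    refine RecursiveIn.partrec_of_oracle ?_ hy.2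
    rintro g rfl
    exact ((Primrec.dom_finite Bool.toNat).to_comp.comp hx).partrec
  refine Function.Injective.countable (β := {f : ℕ → ℕ // Computable f})
    (f := fun y : {y | TEquiv x y} => ⟨fun n => (y.1 n).toNat, hcomp y.1 y.2⟩) ?_
  intro y z h
  have h' := congrArg Subtype.val h
  exact Subtype.ext (funext fun n => by
    have hn : (y.1 n).toNat = (z.1 n).toNat := congrFun h' n
    cases hy : y.1 n <;> cases hz : z.1 n <;> simp_all)

/-! ### Initial segments and Baire category -/

theorem IsInitSeg.of_append {σ τ : List Bool} {x : Cantor} (h : IsInitSeg (σ ++ τ) x) :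
    IsInitSeg σ x := by
  intro i hi
  rw [← h i (by simp; omega), List.getElem_append_left hi]

theorem isInitSeg_map_range (x : Cantor) (n : ℕ) : IsInitSeg ((List.range n).map x) x := by
  intro i hi
  simp

theorem IsInitSeg.eq_map_range {σ : List Bool} {x : Cantor} (h : IsInitSeg σ x) :
    σ = (List.range σ.length).map x :=
  List.ext_getElem (by simp) fun i hi _ => by simpa using h i hi

theorem IsInitSeg.take {σ : List Bool} {x : Cantor} (h : IsInitSeg σ x) (n : ℕ) :
    IsInitSeg (σ.take n) x := by
  intro i hi
  rw [List.getElem_take]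
  exact h i _

theorem IsInitSeg.map_range_eq_take {σ : List Bool} {x : Cantor} (h : IsInitSeg σ x) {n : ℕ}
    (hn : n ≤ σ.length) : (List.range n).map x = σ.take n :=
  List.ext_getElem (by simpa using hn) fun i hi hi' => by
    simp only [List.getElem_map, List.getElem_range, List.getElem_take]
    exact (h i _).symm

theorem isOpen_setOf_isInitSeg (σ : List Bool) : IsOpen {x : Cantor | IsInitSeg σ x} := by
  have : {x : Cantor | IsInitSeg σ x} = ⋂ i : Fin σ.length, {x | σ[i] = x i} := by
    ext x
    simp only [Set.mem_ofPred_eq, Set.mem_iInter]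
    exact ⟨fun h i => h i i.2, fun h i hi => h ⟨i, hi⟩⟩
  rw [this]
  exact isOpen_iInter_of_finite fun i =>
    (isOpen_discrete {b : Bool | σ[i] = b}).preimage (continuous_apply (i : ℕ))

theorem exists_isInitSeg (σ : List Bool) : ∃ x : Cantor, IsInitSeg σ x :=
  ⟨fun i => σ.getD i false, fun i hi => by simp [hi]⟩

/-- Every open neighbourhood of a real contains the basic open set of an initial segment. -/
theorem exists_isInitSeg_subset {x : Cantor} {V : Set Cantor} (hV : IsOpen V) (hx : x ∈ V) :
    ∃ σ, IsInitSeg σ x ∧ ∀ y, IsInitSeg σ y → y ∈ V := by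
  obtain ⟨_, ⟨z, n, rfl⟩, hxz, hsub⟩ :=
    (PiNat.isTopologicalBasis_cylinders (fun _ : ℕ => Bool)).exists_subset_of_mem_open hx hV
  refine ⟨(List.range n).map x, isInitSeg_map_range x n, fun y hy => hsub ?_⟩
  rw [PiNat.mem_cylinder_iff] at hxz ⊢
  intro i hi
  rw [← hxz i hi, ← hy i (by simpa using hi)]
  simp

theorem dense_compl_singleton (x : Cantor) : Dense ({x}ᶜ : Set Cantor) := by
  refine dense_iff_inter_open.2 fun V hV ⟨z, hz⟩ => ?_
  obtain ⟨σ, hσ, hsub⟩ := exists_isInitSeg_subset hV hz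
  obtain ⟨y, hy⟩ := exists_isInitSeg (σ ++ [!x σ.length])
  refine ⟨y, hsub y hy.of_append, fun h => ?_⟩
  have := hy σ.length (by simp)
  rw [Set.mem_singleton_iff.1 h] at this
  simp at this

theorem compl_mem_residual_of_countable {S : Set Cantor} (hS : S.Countable) :
    Sᶜ ∈ residual Cantor := by
  have : Sᶜ = ⋂ x ∈ S, ({x}ᶜ : Set Cantor) := by
    ext y
    simp only [Set.mem_compl_iff, Set.mem_iInter, Set.mem_singleton_iff]
    exact ⟨fun h x hx hyx => h (hyx ▸ hx), fun h hy => h y hy rfl⟩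
  rw [this]
  exact (countable_bInter_mem hS).2 fun x _ =>
    residual_of_dense_open isOpen_compl_singleton (dense_compl_singleton x)

/-! ### The effective construction -/

/-- Iterating a computable rule for extending strings, starting from a given string, produces a
computable real taking both values infinitely often. -/
theorem exists_computable_of_step {step : ℕ × List Bool → List Bool} (hstep : Computable step)
    (τ : List Bool) : ∃ y : Cantor, Computable y ∧ y.IsBiInfinite ∧
      ∀ m, ∃ σ, IsInitSeg (τ ++ σ ++ step (m, σ)) y := by
  -- The block `[false, true]` supplies both values at each stage and forces length at least `n`, so
  -- bit `i` can be read from `t (i + 1)` and the default is never used.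
  let t : ℕ → List Bool := fun n =>
    Nat.rec [] (fun m σ => σ ++ step (m, σ) ++ [false, true]) n
  have ht : Computable t := by
    refine Computable.nat_rec (f := fun n : ℕ => n) (g := fun _ => [])
      (h := fun _ q => q.2 ++ step (q.1, q.2) ++ [false, true]) Computable.id
      (Computable.const []) ?_
    exact Computable.list_append.comp (Computable.list_append.comp
      (Computable.snd.comp Computable.snd) (hstep.comp Computable.snd))
      (Computable.const [false, true])
  have htsucc : ∀ n, t (n + 1) = t n ++ step (n, t n) ++ [false, true] := fun n => rfl
  have hlen : ∀ n, n ≤ (t n).length := by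
    intro n
    induction n with
    | zero => simp
    | succ n ih => rw [htsucc]; simp; omega
  have hmono : ∀ {m n}, m ≤ n → t m <+: t n := by
    intro m n h
    induction h with
    | refl => exact List.prefix_rfl
    | step _ ih => exact ih.trans (by rw [htsucc, List.append_assoc]; exact List.prefix_append _ _)
  let y : Cantor := fun i => (τ ++ t (i + 1)).getD i false
  have hinit : ∀ n, IsInitSeg (τ ++ t n) y := by
    intro n i hi
    have hi' : i < (τ ++ t (i + 1)).length := by
      have := hlen (i + 1)
      simp; omega
    have hpre : ∀ {m n}, m ≤ n → τ ++ t m <+: τ ++ t n := fun h =>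
      (List.prefix_append_right_inj τ).2 (hmono h)
    change _ = (τ ++ t (i + 1)).getD i false
    rw [List.getD_eq_getElem _ _ hi']
    rcases le_total n (i + 1) with h | h
    · exact (hpre h).getElem hi
    · exact ((hpre h).getElem hi').symm
  have hinit' : ∀ n, IsInitSeg ((τ ++ t n ++ step (n, t n)) ++ [false, true]) y := by
    intro n
    have := hinit (n + 1)
    rwa [htsucc, ← List.append_assoc, ← List.append_assoc] at this
  refine ⟨y, ?_, ?_, fun m => ⟨t m, (hinit' m).of_append⟩⟩
  · exact (Primrec.list_getD false).to_comp.comp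
      (Computable.list_append.comp (Computable.const τ) (ht.comp Computable.succ)) Computable.id
  · intro b N
    have h0 := hlen N
    set σ := τ ++ t N ++ step (N, t N) with hσ
    have hle : N ≤ σ.length := by simp [hσ]; omega
    cases b with
    | false => exact ⟨σ.length, hle, by rw [← hinit' N σ.length (by simp [hσ])]; simp [hσ]⟩
    | true =>
      exact ⟨σ.length + 1, by omega, by
        rw [← hinit' N (σ.length + 1) (by simp [hσ]; omega)]; simp [← hσ]⟩

/-- If every computable real taking both values infinitely often lies in the union of the closed
sets `{y | ∀ n, R x y l m n}`, for `x` computable and `l` fixed, then each basic open set has a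
basic open subset that is contained in one of them. -/
theorem exists_subset_of_forall_computable {R : Cantor → Cantor → ℕ → ℕ → ℕ → Prop}
    (hR : IsSemirecursive fun x y l m n => ¬ R x y l m n) {x : Cantor} (hx : Computable x) (l : ℕ)
    (hcomp : ∀ y : Cantor, Computable y → y.IsBiInfinite → ∃ m, ∀ n, R x y l m n)
    (τ : List Bool) :
    ∃ σ m, ∀ y, IsInitSeg (τ ++ σ) y → ∀ n, R x y l m n := by
  by_contra! hcon
  obtain ⟨W, hW, hRW⟩ := hR
  have hmap : Computable fun k : ℕ => (List.range k).map x := by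
    have : Computable fun k : ℕ => (Nat.rec [] (fun i σ => σ ++ [x i]) k : List Bool) :=
      Computable.nat_rec (f := fun n : ℕ => n) (g := fun _ => ([] : List Bool))
        (h := fun _ q => q.2 ++ [x q.1]) Computable.id (Computable.const [])
        (Computable.list_concat.comp (Computable.snd.comp Computable.snd)
          (hx.comp (Computable.fst.comp Computable.snd)))
    refine this.of_eq fun k => ?_
    induction k with
    | zero => rfl
    | succ k ih => simp only [List.range_succ, List.map_append, List.map_cons, List.map_nil, ← ih]
  -- The second component holds the lengths of the two initial segments, the witness `n`, and an
  -- extension of `τ ++ σ` long enough to contain the initial segment of `y`.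
  let code : (ℕ × List Bool) × (ℕ × ℕ × ℕ × List Bool) → List Bool × List Bool × ℕ × ℕ × ℕ :=
    fun p => ((List.range p.2.1).map x, (τ ++ p.1.2 ++ p.2.2.2.2).take p.2.2.1, l, p.1.1, p.2.2.2.1)
  have hcode : Computable code := by
    have h2 : Computable fun p : (ℕ × List Bool) × (ℕ × ℕ × ℕ × List Bool) => p.2.2 :=
      Computable.snd.comp Computable.snd
    have h3 : Computable fun p : (ℕ × List Bool) × (ℕ × ℕ × ℕ × List Bool) => p.2.2.2 :=
      Computable.snd.comp h2
    exact (hmap.comp (Computable.fst.comp Computable.snd)).pair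
      ((Primrec.list_take.to_comp.comp (Computable.fst.comp h2)
        (Computable.list_append.comp (Computable.list_append.comp (Computable.const τ)
          (Computable.snd.comp Computable.fst)) (Computable.snd.comp h3))).pair
      ((Computable.const l).pair
        ((Computable.fst.comp Computable.fst).pair (Computable.fst.comp h3))))
  have htot : ∀ a, ∃ b, W (code (a, b)) := by
    rintro ⟨m, σ⟩
    obtain ⟨y, hy, n, hn⟩ := hcon σ m
    obtain ⟨ξ, η, hξ, hη, hw⟩ := (hRW x y l m n).1 hn
    let N := max (τ ++ σ).length η.length
    refine ⟨(ξ.length, η.length, n, ((List.range N).map y).drop (τ ++ σ).length), ?_⟩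
    have hsplit : τ ++ σ ++ ((List.range N).map y).drop (τ ++ σ).length = (List.range N).map y := by
      have h1 := (isInitSeg_map_range y N).map_range_eq_take (n := (τ ++ σ).length) (by simp [N])
      rw [← hy.eq_map_range] at h1
      exact (congrArg (· ++ _) h1).trans (List.take_append_drop _ _)
    have htake : ((List.range N).map y).take η.length = η := by
      rw [← (isInitSeg_map_range y N).map_range_eq_take (by simp [N]), ← hη.eq_map_range]
    simp only [code]
    rwa [hsplit, htake, ← hξ.eq_map_range]
  obtain ⟨f, hf, hfW⟩ := (hW.comp hcode).exists_computable_selector htot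
  obtain ⟨y, hyc, hyi, hy⟩ := exists_computable_of_step (step := fun a => (f a).2.2.2)
    (Computable.snd.comp (Computable.snd.comp (Computable.snd.comp hf))) τ
  obtain ⟨m, hm⟩ := hcomp y hyc hyi
  -- Stage `m` of the construction made `y` leave the `m`-th closed set.
  obtain ⟨σ, hσ⟩ := hy m
  exact (hRW x y l m _).2 ⟨_, _, isInitSeg_map_range x _, hσ.take _, hfW (m, σ)⟩ (hm _)

theorem isBiInfinite_bodd : IsBiInfinite Nat.bodd := by
  intro b N
  cases b with
  | false => exact ⟨2 * N, by omega, by simp⟩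
  | true => exact ⟨2 * N + 1, by omega, by simp⟩

theorem not_isLightfacePi03_of_between {E : Cantor → Cantor → Prop}
    (hlow : ∀ x y, OneEquiv x y → E x y) (hup : ∀ x y, E x y → TEquiv x y) :
    ¬ IsLightfacePi03 E := by
  rintro ⟨R, ⟨-, hR⟩, hER⟩
  have hx : Computable (Nat.bodd : Cantor) := Computable.nat_bodd
  have hres : ∀ l, {y : Cantor | ∃ m, ∀ n, R Nat.bodd y l m n} ∈ residual Cantor := by
    intro l
    have hdense : Dense (interior {y : Cantor | ∃ m, ∀ n, R Nat.bodd y l m n}) := by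
      refine dense_iff_inter_open.2 fun V hV ⟨z, hz⟩ => ?_
      obtain ⟨τ, -, hsub⟩ := exists_isInitSeg_subset hV hz
      obtain ⟨σ, m, hσ⟩ := exists_subset_of_forall_computable hR hx l
        (fun y hyc hyi => (hER _ y).1
          (hlow _ y (oneEquiv_of_computable hx hyc isBiInfinite_bodd hyi)) l) τ
      obtain ⟨y, hy⟩ := exists_isInitSeg (τ ++ σ)
      exact ⟨y, hsub y hy.of_append,
        mem_interior.2 ⟨_, fun w hw => ⟨m, hσ w hw⟩, isOpen_setOf_isInitSeg _, hy⟩⟩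
    exact Filter.mem_of_superset (residual_of_dense_open isOpen_interior hdense) interior_subset
  have hall := Filter.inter_mem (countable_iInter_mem.2 hres)
    (compl_mem_residual_of_countable (countable_setOf_tEquiv hx))
  obtain ⟨y, hyR, hyT⟩ := (dense_of_mem_residual hall).nonempty
  exact hyT (hup _ y ((hER _ y).2 fun l => Set.mem_iInter.1 hyR l))

end Cantor

theorem mainTheorem9 :
    ¬ Cantor.IsLightfacePi03 Cantor.MEquiv ∧
    ¬ Cantor.IsLightfacePi03 Cantor.OneEquiv ∧
    ∀ E : Cantor → Cantor → Prop,
      (∀ x y, Cantor.OneEquiv x y → E x y) →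
      (∀ x y, E x y → Cantor.TEquiv x y) →
      ¬ Cantor.IsLightfacePi03 E :=
  ⟨Cantor.not_isLightfacePi03_of_between (fun _ _ h => h.mEquiv) fun _ _ h => h.tEquiv,
    Cantor.not_isLightfacePi03_of_between (fun _ _ h => h) fun _ _ h => h.mEquiv.tEquiv,
    fun _ hlow hup => Cantor.not_isLightfacePi03_of_between hlow hup⟩
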